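/- Let $\mathbb{K}$ be a field and $E$ a finite set. A \emph{surjective finite abelian group structure} $\mathcal G$ on a simplicial complex $\Delta\ni\emptyset$ on $E$ assigns to every $S\in\Delta$ a finite abelian group $\mathcal G(S)$ and to every inclusion $S\subseteq T$ in $\Delta$ a surjective homomorphism $\pi_{S,T}:\mathcal G(T)\to\mathcal G(S)$, functorially. Its \emph{independence poset} is $\mathrm{ind}(E,\Delta,\mathcal G)=\{(S,g): S\in\Delta,\ g\in\mathcal G(S)\}$, where $(S,h)\le(T,g)$ iff $S\subseteq T$ and $\pi_{S,T}(g)=h$. The associated torsion-free structure $\tilde{\mathcal G}$ has $\tilde{\mathcal G}(S)=\ker\pi_{\emptyset,S}$ and the restricted maps. A finite poset $P$ is \emph{simplicial} if it has a least element $\hat 0$ and every interval $[\hat 0,y]$ is a boolean algebra; let $\rho(y)$ be the rank of $[\hat 0,y]$. The \emph{Stanley--Reisner ring} $\mathbb{K}[P]$ is the quotient of the polynomial ring over $\mathbb{K}$ in the elements of $P$ by the ideal generated by $ab$ for all $a,b\in P$ without a common upper bound, by $ab-(a\wedge b)\sum_z z$ ($z$ ranging over the minimal upper bounds of $a$ and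 $b$) for all other $a,b\in P$, and by $\hat 0-1$. It is graded by $\deg y=\rho(y)$. Let $\mathcal A=(E,\Delta,m)$ consist of a matroid $(E,\Delta)$ with independence complex $\Delta$, rank function $\mathrm{rk}$ and rank $r=\mathrm{rk}(E)$, and of a multiplicity function $m:2^E\to\mathbb{Z}_{\ge 0}$. Its arithmetic Tutte polynomial is $$T_{\mathcal A}(x,y)=\sum_{S\subseteq E}m(S)(x-1)^{r-\mathrm{rk}(S)}(y-1)^{|S|-\mathrm{rk}(S)}.$$ Suppose that one of the following holds. (1) $\mathcal A$ is an arithmetic matroid, i.e. $m\ge 1$ on $2^E$ and (P) whenever $S=R\sqcup F\sqcup T$ and $\mathrm{rk}(B)=\mathrm{rk}(R)+|B\cap F|$ for all $R\subseteq B\subseteq S$ (so that $[R,S]$ is a molecule), $(-1)^{|T|}\sum_{R\subseteq B\subseteq S}(-1)^{|S|-|B|}m(B)\ge 0$; (A1) for $S\subseteq E$ and $e\in E$, $m(S\cup\{e\})\mid m(S)$ if $\mathrm{rk}(S\cup\{e\})=\mathrm{rk}(S)$, and $m(S)\mid m(S\cup\{e\})$ otherwise; (A2) $m(R)m(S)=m(R\cup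 F)m(R\cup T)$ for every molecule $[R,S]$, $S=R\sqcup F\sqcup T$. Moreover $\mathcal A$ is represented by an integer matrix $X$ with $d$ rows and columns $(x_e)_{e\in E}$: $\Delta$ consists of the $S\subseteq E$ whose columns are linearly independent over $\mathbb{R}$, and $m(S)=|(\langle S\rangle_{\mathbb{R}}\cap\mathbb{Z}^d)/\langle S\rangle|$ for all $S\subseteq E$, where $\langle S\rangle$ and $\langle S\rangle_{\mathbb R}$ are the subgroup and the real subspace generated by $\{x_e:e\in S\}$. Put $\mathcal G(S)=(X[S]^T\mathbb{R}^d\cap\mathbb{Z}^S)/X[S]^T\mathbb{Z}^d$ (the layer group), where $X[S]$ is the submatrix of the columns in $S$, with the maps $\mathcal G(T)\to\mathcal G(S)$ induced by the coordinate projections $\mathbb{Z}^T\to\mathbb{Z}^S$. (2) $\mathcal A$ is a weak quasi-arithmetic matroid, i.e. $m(S)\ge 1$ for $S\in\Delta$ and $m(S)\mid m(S\cup\{x\})$ whenever $S\cup\{x\}\in\Delta$ (the values of $m$ on dependent sets are arbitrary; they do not affect $T_{\mathcal A}(x,1)$). Put $\mathcal G(S)=\mathbb{Z}/m(S)\mathbb{Z}$,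 with the canonical projections. Let $P=\mathrm{ind}(E,\Delta,\mathcal G)$ and $\tilde P=\mathrm{ind}(E,\Delta,\tilde{\mathcal G})$. Then in both cases the following holds. If $m(\emptyset)=1$, then $P$ is a simplicial poset, the graded components of $\mathbb{K}[P]$ are finite-dimensional, and $$\mathrm{Hilb}(\mathbb{K}[P],t)=\frac{t^r\,T_{\mathcal A}(\tfrac1t,1)}{(1-t)^r}.$$ In general, $\tilde P$ is a simplicial poset, the graded components of $\mathbb{K}[\tilde P]$ are finite-dimensional, and $$\mathrm{Hilb}(\mathbb{K}[\tilde P],t)=\frac{1}{m(\emptyset)}\cdot\frac{t^r\,T_{\mathcal A}(\tfrac1t,1)}{(1-t)^r}.$$ -/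

import Mathlib

open Polynomial

noncomputable section

universe u v w

/-! ### Simplicial complexes with a surjective finite abelian group structure -/

/-- A simplicial complex on the ground set `E` (the empty set is a face). -/
structure FaceComplex (E : Type u) where
  faces : Set (Finset E)
  empty_mem : ∅ ∈ faces
  down_closed : ∀ ⦃S T : Finset E⦄, T ∈ faces → S ⊆ T → S ∈ faces

namespace FaceComplex

/-- The faces of `Δ`, ordered by inclusion. -/
abbrev Face {E : Type u} (Δ : FaceComplex E) : Type u := {S : Finset E // S ∈ Δ.faces}

/-- The empty face. -/
def emptyFace {E : Type u} (Δ : FaceComplex E) : Δ.Face := ⟨∅, Δ.empty_mem⟩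

theorem emptyFace_le {E : Type u} (Δ : FaceComplex E) (S : Δ.Face) : Δ.emptyFace ≤ S :=
  Finset.empty_subset S.1

end FaceComplex

/-- A surjective finite abelian group structure on `Δ`: a (contravariant) functor from the
poset of faces of `Δ` to finite abelian groups all of whose maps are surjective. -/
structure SurjFinAbStructure {E : Type u} (Δ : FaceComplex E) where
  grp : Δ.Face → Type w
  [addCommGroup : ∀ S, AddCommGroup (grp S)]
  [finite : ∀ S, Finite (grp S)]
  map : ∀ {S T : Δ.Face}, S ≤ T → grp T →+ grp S
  map_id : ∀ (S : Δ.Face) (g : grp S), map (le_refl S) g = g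
  map_comp : ∀ {R S T : Δ.Face} (h : R ≤ S) (k : S ≤ T) (g : grp T),
    map h (map k g) = map (h.trans k) g
  map_surjective : ∀ {S T : Δ.Face} (h : S ≤ T), Function.Surjective (map h)

attribute [instance] SurjFinAbStructure.addCommGroup SurjFinAbStructure.finite

namespace SurjFinAbStructure

variable {E : Type u} {Δ : FaceComplex E}

/-- The map `π_S : 𝒢(S) → 𝒢(∅)`. -/
def toEmpty (G : SurjFinAbStructure.{u, w} Δ) (S : Δ.Face) : G.grp S →+ G.grp Δ.emptyFace :=
  G.map (Δ.emptyFace_le S)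

/-- The associated torsion-free structure: `𝒢̃(S)` is the kernel of `π_S : 𝒢(S) → 𝒢(∅)`, and
the maps are the restrictions of those of `𝒢`. -/
def torsionFreePart (G : SurjFinAbStructure.{u, w} Δ) : SurjFinAbStructure.{u, w} Δ where
  grp S := (G.toEmpty S).ker
  map {S T} h := ((G.map h).comp (G.toEmpty T).ker.subtype).codRestrict (G.toEmpty S).ker (by
    rintro ⟨g, hg⟩
    have hg' : G.map (Δ.emptyFace_le T) g = 0 := hg
    change G.map (Δ.emptyFace_le S) (G.map h g) = 0
    rw [G.map_comp, hg'])
  map_id S g := Subtype.ext (G.map_id S g.1)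
  map_comp h k g := Subtype.ext (G.map_comp h k g.1)
  map_surjective {S T} h := by
    rintro ⟨g, hg⟩
    obtain ⟨k, hk⟩ := G.map_surjective h g
    have hg' : G.map (Δ.emptyFace_le S) g = 0 := hg
    refine ⟨⟨k, ?_⟩, Subtype.ext hk⟩
    change G.map (Δ.emptyFace_le T) k = 0
    rw [← hg', ← hk, G.map_comp]

end SurjFinAbStructure

/-- The underlying set `{(S, g) : S ∈ Δ, g ∈ 𝒢(S)}` of the independence poset. -/
@[ext]
structure IndPoset {E : Type u} {Δ : FaceComplex E} (G : SurjFinAbStructure.{u, w} Δ) where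
  face : Δ.Face
  elt : G.grp face

namespace IndPoset

variable {E : Type u} {Δ : FaceComplex E} {G : SurjFinAbStructure.{u, w} Δ}

/-- `(S, h) ≤ (T, g)` if and only if `S ⊆ T` and `g ↦ h` under `𝒢(T) → 𝒢(S)`; this is the order
in which, for `T = S ∪ {a}` with `a ∉ S`, `(T, g)` covers `(S, h)` exactly if `g ↦ h`. -/
instance : PartialOrder (IndPoset G) where
  le p q := ∃ h : p.face ≤ q.face, G.map h q.elt = p.elt
  le_refl p := ⟨le_refl _, G.map_id _ _⟩
  le_trans p q r := by
    rintro ⟨h, hh⟩ ⟨k, hk⟩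
    exact ⟨h.trans k, by rw [← G.map_comp h k, hk, hh]⟩
  le_antisymm p q := by
    obtain ⟨S, g⟩ := p
    obtain ⟨T, k⟩ := q
    rintro ⟨h, hh⟩ ⟨h', -⟩
    obtain rfl : S = T := le_antisymm h h'
    have hh' : k = g := (G.map_id S k).symm.trans hh
    rw [hh']

instance [Finite E] : Finite (IndPoset G) :=
  Finite.of_injective (β := Σ S : Δ.Face, G.grp S) (fun p => ⟨p.face, p.elt⟩) (by
    rintro ⟨S, g⟩ ⟨T, k⟩ h
    simpa using h)

end IndPoset

/-! ### Simplicial posets and their Stanley–Reisner rings -/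

section StanleyReisner

/-- A (finite) poset is simplicial if it has a least element `0̂` and all intervals `[0̂, y]` are
finite boolean algebras. -/
def IsSimplicialPoset (P : Type u) [PartialOrder P] : Prop :=
  ∃ b : P, IsBot b ∧ ∀ y : P, ∃ n : ℕ, Nonempty (Set.Icc b y ≃o Finset (Fin n))

/-- The rank `ρ(y)` of the interval `[0̂, y]`, i.e. the length of a longest chain below `y`. -/
def posetRank {P : Type u} [PartialOrder P] (y : P) : ℕ := (Order.height y).toNat

variable (K : Type v) [Field K] (P : Type u) [PartialOrder P] [Finite P]

/-- The Stanley–Reisner ideal of a finite simplicial poset `P`. -/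
def stanleyReisnerIdeal : Ideal (MvPolynomial P K) :=
  Ideal.span
    ({f | ∃ a b : P, (¬ ∃ z, a ≤ z ∧ b ≤ z) ∧ f = MvPolynomial.X a * MvPolynomial.X b} ∪
     {f | ∃ a b c : P, (∃ z, a ≤ z ∧ b ≤ z) ∧ IsGLB {a, b} c ∧
        f = MvPolynomial.X a * MvPolynomial.X b - MvPolynomial.X c *
          ∑ z ∈ (Set.toFinite {z : P | Minimal (fun y => a ≤ y ∧ b ≤ y) z}).toFinset,
            MvPolynomial.X z} ∪
     {f | ∃ b : P, IsBot b ∧ f = MvPolynomial.X b - 1})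

/-- The Stanley–Reisner ring `K[P]`. -/
abbrev StanleyReisnerRing : Type (max u v) := MvPolynomial P K ⧸ stanleyReisnerIdeal K P

/-- The degree-`n` part of `K[P]` for the grading with `deg y = ρ(y)`: the image of the
polynomials that are weighted homogeneous of degree `n`. -/
def stanleyReisnerPiece (n : ℕ) : Submodule K (StanleyReisnerRing K P) :=
  (MvPolynomial.weightedHomogeneousSubmodule K (posetRank : P → ℕ) n).map
    (Ideal.Quotient.mkₐ K (stanleyReisnerIdeal K P)).toLinearMap

/-- The Hilbert series of `K[P]`. -/
def stanleyReisnerHilbertSeries : PowerSeries ℚ :=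
  PowerSeries.mk fun n => (Module.finrank K (stanleyReisnerPiece K P n) : ℚ)

/-- `K[P]` has finite-dimensional graded components and its Hilbert series is `F`. -/
def HasHilbertSeries (F : PowerSeries ℚ) : Prop :=
  (∀ n, Module.Finite K (stanleyReisnerPiece K P n)) ∧ stanleyReisnerHilbertSeries K P = F

end StanleyReisner

/-! ### Matroids with multiplicities -/

/-- A matroid on the finite ground set `E` with a function `m` on the subsets of `E`. -/
structure MultMatroid (E : Type u) where
  matroid : Matroid E
  ground_eq : matroid.E = Set.univ
  m : Finset E → ℕ

namespace MultMatroid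

variable {E : Type u}

/-- The rank function. -/
def rk (A : MultMatroid E) (S : Finset E) : ℕ := (A.matroid.eRk (S : Set E)).toNat

/-- The rank of the matroid. -/
def rank (A : MultMatroid E) [Fintype E] : ℕ := A.rk Finset.univ

/-- The independence complex. -/
def complex (A : MultMatroid E) : FaceComplex E where
  faces := {S | A.matroid.Indep (S : Set E)}
  empty_mem := by simp
  down_closed S T hT hST := by
    have hT' : A.matroid.Indep (T : Set E) := hT
    exact hT'.subset (by exact_mod_cast hST)

/-- `[R, S]` is a molecule with `S = R ⊔ F ⊔ T`. -/
def IsMolecule [DecidableEq E] (A : MultMatroid E) (R S F T : Finset E) : Prop :=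
  Disjoint R F ∧ Disjoint R T ∧ Disjoint F T ∧ S = R ∪ F ∪ T ∧
    ∀ B ∈ Finset.Icc R S, A.rk B = A.rk R + (B ∩ F).card

/-- Arithmetic matroids: positivity of `m` and the axioms (P), (A1) and (A2). -/
structure IsArithmetic [DecidableEq E] (A : MultMatroid E) : Prop where
  pos : ∀ S, 1 ≤ A.m S
  molecule_nonneg : ∀ R S F T, A.IsMolecule R S F T →
    0 ≤ (-1 : ℤ) ^ T.card * ∑ B ∈ Finset.Icc R S, (-1) ^ (S.card - B.card) * (A.m B : ℤ)
  dvd_of_rk_eq : ∀ S e, A.rk (insert e S) = A.rk S → A.m (insert e S) ∣ A.m S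
  dvd_of_rk_ne : ∀ S e, A.rk (insert e S) ≠ A.rk S → A.m S ∣ A.m (insert e S)
  molecule_mul : ∀ R S F T, A.IsMolecule R S F T →
    A.m R * A.m S = A.m (R ∪ F) * A.m (R ∪ T)

/-- Weak quasi-arithmetic matroids: only the values of `m` on independent sets are constrained
(the values on dependent sets are irrelevant; they do not enter `T_𝒜(x, 1)`). -/
structure IsWeakQuasiArithmetic [DecidableEq E] (A : MultMatroid E) : Prop where
  pos : ∀ S ∈ A.complex.faces, 1 ≤ A.m S
  dvd : ∀ S x, insert x S ∈ A.complex.faces → A.m S ∣ A.m (insert x S)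

/-- The arithmetic Tutte polynomial
`T(x, y) = ∑_{S ⊆ E} m(S) (x - 1)^(r - rk S) (y - 1)^(|S| - rk S)`, as an element of `ℤ[x][y]`. -/
def tutte [Fintype E] (A : MultMatroid E) : Polynomial (Polynomial ℤ) :=
  ∑ S : Finset E, (A.m S : Polynomial (Polynomial ℤ)) *
    C ((X - 1 : Polynomial ℤ) ^ (A.rank - A.rk S)) * (X - 1) ^ (S.card - A.rk S)

/-- The power series `t^r T(1/t, 1) / (1 - t)^r`. Since `T(x, 1)` has degree at most `r`, the
polynomial `t^r T(1/t, 1)` is obtained by reversing its coefficients `c₀, …, c_r`. -/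
def tutteSeries [Fintype E] (A : MultMatroid E) : PowerSeries ℚ :=
  ((((A.tutte.eval 1).reflect A.rank).map (Int.castRingHom ℚ) : Polynomial ℚ) : PowerSeries ℚ) *
    ((1 - PowerSeries.X) ^ A.rank)⁻¹

section Cyclic

variable [DecidableEq E] {A : MultMatroid E}

theorem IsWeakQuasiArithmetic.dvd_of_subset (hA : A.IsWeakQuasiArithmetic) {S T : Finset E}
    (hST : S ⊆ T) (hT : T ∈ A.complex.faces) : A.m S ∣ A.m T := by
  induction T using Finset.strongInduction with
  | H T ih =>
    by_cases h : S = T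
    · rw [h]
    · obtain ⟨x, hxT, hxS⟩ := Finset.exists_of_ssubset (hST.ssubset_of_ne h)
      have h1 : S ⊆ T.erase x := fun y hy =>
        Finset.mem_erase.2 ⟨fun h => hxS (h ▸ hy), hST hy⟩
      have h2 := ih _ (Finset.erase_ssubset hxT) h1
        (A.complex.down_closed hT (Finset.erase_subset _ _))
      have h3 := hA.dvd (T.erase x) x (by rwa [Finset.insert_erase hxT])
      rw [Finset.insert_erase hxT] at h3
      exact h2.trans h3

/-- The cyclic structure `S ↦ ℤ/m(S)ℤ`, with the projections `1 ↦ 1`. -/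
def cyclicStructure (A : MultMatroid E) (hA : A.IsWeakQuasiArithmetic) :
    SurjFinAbStructure.{u, 0} A.complex where
  grp S := ZMod (A.m S.1)
  finite S := by
    have : NeZero (A.m S.1) := ⟨Nat.one_le_iff_ne_zero.1 (hA.pos S.1 S.2)⟩
    infer_instance
  map {S T} h := (ZMod.castHom (hA.dvd_of_subset h T.2) (ZMod (A.m S.1))).toAddMonoidHom
  map_id S g := by simp
  map_comp {R S T} h k g := congrArg (fun f : ZMod (A.m T.1) →+* ZMod (A.m R.1) => f g)
    (ZMod.castHom_comp (hA.dvd_of_subset h S.2) (hA.dvd_of_subset k T.2))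
  map_surjective {S T} h := ZMod.castHom_surjective (hA.dvd_of_subset h T.2)

end Cyclic

end MultMatroid

/-! ### Representations by integer matrices and layer groups -/

section Layer

variable {E : Type u} {d : ℕ}

/-- The submatrix `X[S]` of the columns of `X` indexed by `S`. -/
def columnSubmatrix (X : Matrix (Fin d) E ℤ) (S : Finset E) : Matrix (Fin d) S ℤ :=
  X.submatrix id Subtype.val

/-- The sets of columns that are linearly independent over `ℝ`. -/
def columnComplex (X : Matrix (Fin d) E ℤ) : FaceComplex E where
  faces := {S | LinearIndepOn ℝ (fun (e : E) (i : Fin d) => (X i e : ℝ)) (S : Set E)}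
  empty_mem := by simp
  down_closed S T hT hST := by
    have hT' : LinearIndepOn ℝ (fun (e : E) (i : Fin d) => (X i e : ℝ)) (T : Set E) := hT
    exact hT'.mono (by exact_mod_cast hST)

/-- The subgroup `⟨S⟩` of `ℤ^d` generated by the columns indexed by `S`. -/
def columnLattice (X : Matrix (Fin d) E ℤ) (S : Finset E) : AddSubgroup (Fin d → ℤ) :=
  AddSubgroup.closure ((fun e i => X i e) '' (S : Set E))

/-- The group `⟨S⟩_ℝ ∩ ℤ^d`. -/
def columnSaturation (X : Matrix (Fin d) E ℤ) (S : Finset E) : AddSubgroup (Fin d → ℤ) :=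
  (Submodule.span ℝ ((fun (e : E) (i : Fin d) => (X i e : ℝ)) '' (S : Set E))).toAddSubgroup.comap
    ((Int.castAddHom ℝ).compLeft (Fin d))

/-- The integer matrix `X` represents `𝒜 = (E, Δ, m)`: the independent sets are the linearly
independent sets of columns and `m(S) = |(⟨S⟩_ℝ ∩ ℤ^d) / ⟨S⟩|` for all `S ⊆ E`. -/
def MultMatroid.IsRepresentedBy (A : MultMatroid E) (X : Matrix (Fin d) E ℤ) : Prop :=
  A.complex.faces = (columnComplex X).faces ∧
    ∀ S : Finset E, A.m S =
      Nat.card (columnSaturation X S ⧸ (columnLattice X S).addSubgroupOf (columnSaturation X S))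

/-- `W(S) = X[S]ᵀ ℝ^d ∩ ℤ^S`. -/
def layerW (X : Matrix (Fin d) E ℤ) (S : Finset E) : AddSubgroup (S → ℤ) :=
  (LinearMap.range
    ((columnSubmatrix X S).transpose.map (Int.cast : ℤ → ℝ)).mulVecLin).toAddSubgroup.comap
    ((Int.castAddHom ℝ).compLeft S)

/-- `I(S) = X[S]ᵀ ℤ^d`. -/
def layerI (X : Matrix (Fin d) E ℤ) (S : Finset E) : AddSubgroup (S → ℤ) :=
  (LinearMap.range (columnSubmatrix X S).transpose.mulVecLin).toAddSubgroup

/-- The layer group `LG(S) = W(S) / I(S)`. -/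
abbrev LayerGroup (X : Matrix (Fin d) E ℤ) (S : Finset E) : Type u :=
  layerW X S ⧸ (layerI X S).addSubgroupOf (layerW X S)

/-- The projection `W(T) → W(S)` for `S ⊆ T` that forgets the coordinates in `T \ S`. -/
def layerRestrict (X : Matrix (Fin d) E ℤ) {S T : Finset E} (h : S ⊆ T) :
    layerW X T →+ layerW X S where
  toFun w := ⟨fun e => w.1 ⟨e.1, h e.2⟩, by
    obtain ⟨v, hv⟩ := w.2
    exact ⟨v, funext fun e => congrFun hv ⟨e.1, h e.2⟩⟩⟩
  map_zero' := rfl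
  map_add' _ _ := rfl

theorem layerRestrict_le (X : Matrix (Fin d) E ℤ) {S T : Finset E} (h : S ⊆ T) :
    (layerI X T).addSubgroupOf (layerW X T) ≤
      ((layerI X S).addSubgroupOf (layerW X S)).comap (layerRestrict X h) := by
  rintro w ⟨v, hv⟩
  exact ⟨v, funext fun e => congrFun hv ⟨e.1, h e.2⟩⟩

/-- The map `LG(T) → LG(S)` induced by the coordinate projection, for `S ⊆ T`. -/
def layerMap (X : Matrix (Fin d) E ℤ) {S T : Finset E} (h : S ⊆ T) :
    LayerGroup X T →+ LayerGroup X S :=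
  QuotientAddGroup.map _ _ (layerRestrict X h) (layerRestrict_le X h)

/-- For independent `S`, a nonzero integer multiple of every vector of `ℤ^S` lies in `I(S)`. -/
theorem exists_smul_mem_layerI (X : Matrix (Fin d) E ℤ) {S : Finset E}
    (hS : S ∈ (columnComplex X).faces) :
    ∃ k : ℤ, k ≠ 0 ∧ ∀ w : S → ℤ, k • w ∈ layerI X S := by
  classical
  set B := columnSubmatrix X S with hB
  refine ⟨(B.transpose * B).det, ?_, fun w => ?_⟩
  · intro h0
    have h1 : ((B.map (Int.cast : ℤ → ℝ)).transpose * B.map (Int.cast : ℤ → ℝ)).det = 0 := by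
      have := congrArg (Int.castRingHom ℝ) h0
      rw [RingHom.map_det, map_zero] at this
      rw [← this]
      congr 1
      ext i j
      simp [Matrix.mul_apply]
    obtain ⟨x, hx, hx0⟩ := Matrix.exists_mulVec_eq_zero_iff.2 h1
    have h2 : x ∈ LinearMap.ker
        ((B.map (Int.cast : ℤ → ℝ)).transpose * B.map (Int.cast : ℤ → ℝ)).mulVecLin := hx0
    rw [Matrix.ker_mulVecLin_transpose_mul_self] at h2
    have hli : LinearIndependent ℝ (B.map (Int.cast : ℤ → ℝ)).col := hS
    have hinj := Matrix.mulVec_injective_iff.2 hli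
    apply hx
    apply hinj
    rw [Matrix.mulVec_zero]
    exact h2
  · refine ⟨B.mulVec ((B.transpose * B).adjugate.mulVec w), ?_⟩
    change B.transpose.mulVec _ = _
    rw [Matrix.mulVec_mulVec, Matrix.mulVec_mulVec, Matrix.mul_adjugate, Matrix.smul_mulVec,
      Matrix.one_mulVec]

theorem layerW_eq_top (X : Matrix (Fin d) E ℤ) {S : Finset E}
    (hS : S ∈ (columnComplex X).faces) (w : S → ℤ) : w ∈ layerW X S := by
  obtain ⟨k, hk, h⟩ := exists_smul_mem_layerI X hS
  obtain ⟨v, hv⟩ := h w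
  have hk' : (k : ℝ) ≠ 0 := by exact_mod_cast hk
  refine ⟨fun i => (k : ℝ)⁻¹ * v i, funext fun e => ?_⟩
  have h1 := congrArg (Int.cast : ℤ → ℝ) (congrFun hv e)
  simp only [Matrix.mulVecLin_apply, Matrix.mulVec, dotProduct, Matrix.transpose_apply,
    Matrix.map_apply, Int.cast_sum, Int.cast_mul, Pi.smul_apply, smul_eq_mul] at h1 ⊢
  change _ = ((w e : ℤ) : ℝ)
  rw [eq_comm, ← mul_right_inj' hk', ← h1, Finset.mul_sum]
  refine Finset.sum_congr rfl fun i _ => ?_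
  field_simp

theorem finite_layerGroup (X : Matrix (Fin d) E ℤ) {S : Finset E}
    (hS : S ∈ (columnComplex X).faces) : Finite (LayerGroup X S) := by
  obtain ⟨k, hk, h⟩ := exists_smul_mem_layerI X hS
  have : Module.Finite ℤ (layerW X S) :=
    inferInstanceAs (Module.Finite ℤ (AddSubgroup.toIntSubmodule (layerW X S)))
  have : Module.Finite ℤ (LayerGroup X S) :=
    Module.Finite.of_surjective
      (QuotientAddGroup.mk' ((layerI X S).addSubgroupOf (layerW X S))).toIntLinearMap
      (QuotientAddGroup.mk'_surjective _)
  refine Module.finite_of_fg_torsion _ fun g => ?_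
  obtain ⟨w, rfl⟩ := QuotientAddGroup.mk_surjective g
  refine ⟨⟨k, mem_nonZeroDivisors_of_ne_zero hk⟩, ?_⟩
  change k • (w : LayerGroup X S) = 0
  rw [← QuotientAddGroup.mk_zsmul, QuotientAddGroup.eq_zero_iff]
  exact h w.1

theorem layerMap_surjective (X : Matrix (Fin d) E ℤ) {S T : Finset E} (h : S ⊆ T)
    (hT : T ∈ (columnComplex X).faces) : Function.Surjective (layerMap X h) := by
  classical
  intro g
  obtain ⟨w, rfl⟩ := QuotientAddGroup.mk_surjective g
  refine ⟨QuotientAddGroup.mk ⟨fun e => if he : e.1 ∈ S then w.1 ⟨e.1, he⟩ else 0,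
    layerW_eq_top X hT _⟩, ?_⟩
  change QuotientAddGroup.mk (layerRestrict X h _) = _
  congr 1
  refine Subtype.ext (funext fun e => ?_)
  simp [layerRestrict]

/-- The structure `S ↦ LG(S)` on the independence complex of the columns of `X`. -/
def layerStructure (X : Matrix (Fin d) E ℤ) : SurjFinAbStructure.{u, u} (columnComplex X) where
  grp S := LayerGroup X S.1
  finite S := finite_layerGroup X S.2
  map h := layerMap X h
  map_id S g := by
    obtain ⟨w, rfl⟩ := QuotientAddGroup.mk_surjective g
    rfl
  map_comp h k g := by
    obtain ⟨w, rfl⟩ := QuotientAddGroup.mk_surjective g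
    rfl
  map_surjective {S T} h := layerMap_surjective X h T.2

end Layer

end

/-! Below a fixed `y`, an element of the independence poset is determined by its face, and every
subset of the face of `y` occurs. Hence `[0̂, y]` is the boolean algebra of subsets of that face
once `𝒢(∅)` is trivial, and the rank is the size of the face.

In `K[P]` the relation `ab = (a ∧ b) ∑ z` trades incomparable factors for comparable ones, so
monomials straighten into products of multichains (`prod_gen_mem_span`). Up to factors `0̂ = 1`, a
multichain is a pair `(p, α)`: its top `p`, and the exponent vector `α` counting, for each `e`, the
members whose face contains `e`; the support of `α` is the face of `p`. These products are
independent: each `y` gives a ring map `K[P] → K[E]` that sends `z` to the monomial of its face if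
`z ≤ y` and to `0` otherwise, and the coefficient of `α` after evaluation at `p` isolates `(p, α)`
(`linearIndependent_stdFamily`). Counting pairs gives `Hilb = ∑_S |𝒢(S)| (t/(1-t))^|S|`.

At `y = 1` only independent sets contribute to the Tutte polynomial, and `t^r T(1/t, 1)/(1-t)^r =
∑_S m(S) (t/(1-t))^|S|`. So it suffices that `|𝒢(S)| = m(S)`; the factor `1/m(∅)` comes from `|𝒢(S)|
= |𝒢(∅)| |𝒢̃(S)|`.

The order is clear for cyclic groups. For layer groups and independent `S`, `W(S) = ℤ^S`. Since the
saturation of `⟨S⟩` is a direct summand of `ℤ^d`, `I(S)` is the lattice of values of its linear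
forms at the columns. In a basis, `I(S)` and `⟨S⟩` come from transposed matrices, so their indices
are the same determinant (`index_span_eq_index_dual`, `card_layerGroup`). -/

noncomputable section

universe u v w

/-! ### Order structure of independence posets -/

namespace IndPoset

variable {E : Type u} {Δ : FaceComplex E} {G : SurjFinAbStructure.{u, w} Δ}

theorem face_subset {p q : IndPoset G} (h : p ≤ q) : p.face.1 ⊆ q.face.1 := h.1

/-- Below a common upper bound, the order is inclusion of faces. -/
theorem le_of_face_subset {p q z : IndPoset G} (hp : p ≤ z) (hq : q ≤ z)
    (h : p.face.1 ⊆ q.face.1) : p ≤ q := by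
  obtain ⟨hpz, hp⟩ := hp
  obtain ⟨hqz, hq⟩ := hq
  have h' : p.face ≤ q.face := h
  exact ⟨h', by rw [← hq, G.map_comp h' hqz, hp]⟩

theorem eq_of_face_eq {p q z : IndPoset G} (hp : p ≤ z) (hq : q ≤ z)
    (h : p.face.1 = q.face.1) : p = q :=
  le_antisymm (le_of_face_subset hp hq h.le) (le_of_face_subset hq hp h.ge)

/-- The least element `(∅, 0)`, when `𝒢(∅)` is trivial. -/
def bot (G : SurjFinAbStructure.{u, w} Δ) : IndPoset G := ⟨Δ.emptyFace, 0⟩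

theorem isBot_bot [Subsingleton (G.grp Δ.emptyFace)] : IsBot (bot G) := fun p =>
  ⟨Δ.emptyFace_le p.face, Subsingleton.elim (α := G.grp Δ.emptyFace) _ _⟩

theorem eq_bot_of_isBot {b : IndPoset G} [Subsingleton (G.grp Δ.emptyFace)] (hb : IsBot b) :
    b = bot G :=
  le_antisymm (hb _) (isBot_bot _)

theorem eq_bot_of_face_eq_empty [Subsingleton (G.grp Δ.emptyFace)] {p : IndPoset G}
    (h : p.face.1 = ∅) : p = bot G :=
  eq_of_face_eq le_rfl (isBot_bot p) h

variable [DecidableEq E]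

/-- The unique element below `p` whose face is `p.face ∩ S`. -/
def restrict (p : IndPoset G) (S : Finset E) : IndPoset G where
  face := ⟨p.face.1 ∩ S, Δ.down_closed p.face.2 Finset.inter_subset_left⟩
  elt := G.map (show (⟨p.face.1 ∩ S, _⟩ : Δ.Face) ≤ p.face from Finset.inter_subset_left) p.elt

@[simp]
theorem restrict_face (p : IndPoset G) (S : Finset E) :
    (p.restrict S).face.1 = p.face.1 ∩ S := rfl

theorem restrict_le (p : IndPoset G) (S : Finset E) : p.restrict S ≤ p :=
  ⟨Finset.inter_subset_left, rfl⟩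

theorem restrict_eq_self {p : IndPoset G} {S : Finset E} (h : p.face.1 ⊆ S) :
    p.restrict S = p :=
  eq_of_face_eq (restrict_le _ _) le_rfl (Finset.inter_eq_left.2 h)

/-- Restricting `z` to the union of the two faces still gives an upper bound, so minimality leaves
no room for more. -/
theorem minimal_upperBound_face {a b z : IndPoset G}
    (hz : Minimal (fun y => a ≤ y ∧ b ≤ y) z) : z.face.1 = a.face.1 ∪ b.face.1 := by
  obtain ⟨⟨ha, hb⟩, hmin⟩ := hz
  have hab : a.face.1 ∪ b.face.1 ⊆ z.face.1 :=
    Finset.union_subset (face_subset ha) (face_subset hb)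
  refine (face_subset (hmin ⟨?_, ?_⟩ (restrict_le z (a.face.1 ∪ b.face.1)))).trans
    Finset.inter_subset_right |>.antisymm hab
  · exact le_of_face_subset ha (restrict_le _ _)
      (Finset.subset_inter (face_subset ha) Finset.subset_union_left)
  · exact le_of_face_subset hb (restrict_le _ _)
      (Finset.subset_inter (face_subset hb) Finset.subset_union_right)

/-- Below an upper bound of `a` and `b` there is exactly one minimal upper bound. -/
theorem minimal_upperBound_restrict {a b z : IndPoset G} (ha : a ≤ z) (hb : b ≤ z) :
    Minimal (fun y => a ≤ y ∧ b ≤ y) (z.restrict (a.face.1 ∪ b.face.1)) := by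
  refine ⟨⟨?_, ?_⟩, fun y hy hyz => ?_⟩
  · exact le_of_face_subset ha (restrict_le _ _)
      (Finset.subset_inter (face_subset ha) Finset.subset_union_left)
  · exact le_of_face_subset hb (restrict_le _ _)
      (Finset.subset_inter (face_subset hb) Finset.subset_union_right)
  · exact le_of_face_subset (restrict_le _ _) (hyz.trans (restrict_le _ _))
      (Finset.inter_subset_right.trans
        (Finset.union_subset (face_subset hy.1) (face_subset hy.2)))

/-- The common bound `z` reduces all comparisons to inclusions of faces; without it, the
restrictions of `a` and `b` to the common face may differ. -/
theorem isGLB_restrict {a b z : IndPoset G} (ha : a ≤ z) (hb : b ≤ z) :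
    IsGLB {a, b} (a.restrict b.face.1) := by
  constructor
  · rintro x (rfl | rfl)
    · exact restrict_le _ _
    · exact le_of_face_subset ((restrict_le _ _).trans ha) hb Finset.inter_subset_right
  · intro x hx
    have hxa : x ≤ a := hx (by simp)
    have hxb : x ≤ b := hx (by simp)
    exact le_of_face_subset hxa (restrict_le _ _)
      (Finset.subset_inter (face_subset hxa) (face_subset hxb))

theorem isGLB_face {a b c z : IndPoset G} (ha : a ≤ z) (hb : b ≤ z) (hc : IsGLB {a, b} c) :
    c.face.1 = a.face.1 ∩ b.face.1 := by
  rw [hc.unique (isGLB_restrict ha hb), restrict_face]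

theorem isSimplicialPoset [Subsingleton (G.grp Δ.emptyFace)] :
    IsSimplicialPoset (IndPoset G) := by
  refine ⟨bot G, isBot_bot, fun y => ⟨y.face.1.card, ⟨RelIso.symm ?_⟩⟩⟩
  let ι : Fin y.face.1.card ↪ E :=
    y.face.1.equivFin.symm.toEmbedding.trans (Function.Embedding.subtype _)
  have hι : ∀ T : Finset (Fin y.face.1.card), (y.restrict (T.map ι)).face.1 = T.map ι := by
    intro T
    rw [restrict_face, Finset.inter_eq_right]
    intro e he
    obtain ⟨i, -, rfl⟩ := Finset.mem_map.1 he
    exact (y.face.1.equivFin.symm i).2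
  let f : Finset (Fin y.face.1.card) → Set.Icc (bot G) y :=
    fun T => ⟨y.restrict (T.map ι), isBot_bot _, restrict_le _ _⟩
  refine RelIso.ofSurjective (OrderEmbedding.ofMapLEIff f fun S T => ?_) ?_
  · refine ⟨fun h => ?_, fun h => ?_⟩
    · have := face_subset (p := y.restrict (S.map ι)) (q := y.restrict (T.map ι)) h
      rw [hι, hι] at this
      exact Finset.map_subset_map.1 this
    · refine le_of_face_subset (p := y.restrict (S.map ι)) (q := y.restrict (T.map ι))
        (restrict_le _ _) (restrict_le _ _) ?_
      rw [hι, hι]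
      exact Finset.map_subset_map.2 h
  · rintro ⟨p, hp, hpy⟩
    refine ⟨Finset.univ.filter fun i => ι i ∈ p.face.1, Subtype.ext ?_⟩
    change y.restrict _ = p
    refine eq_of_face_eq (restrict_le _ _) hpy ?_
    rw [hι]
    ext e
    simp only [Finset.mem_map, Finset.mem_filter, Finset.mem_univ, true_and]
    refine ⟨?_, fun he => ?_⟩
    · rintro ⟨i, hi, rfl⟩
      exact hi
    · have : ι (y.face.1.equivFin ⟨e, face_subset hpy he⟩) = e := by simp [ι]
      exact ⟨_, by rwa [this], this⟩

/-- The size of the face is strictly monotone, which bounds chains from above; deleting one element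
of the face at a time gives a chain of that length. -/
theorem height_eq (p : IndPoset G) : Order.height p = p.face.1.card := by
  apply le_antisymm
  · have hmono : StrictMono fun q : IndPoset G => q.face.1.card := fun a b h =>
      Finset.card_lt_card ((face_subset h.le).ssubset_of_ne fun he =>
        h.ne (eq_of_face_eq h.le le_rfl he))
    have := Order.height_le_height_apply_of_strictMono _ hmono p
    simpa using this
  · induction hn : p.face.1.card generalizing p with
    | zero => simp
    | succ n ih =>
      obtain ⟨e, he⟩ := Finset.card_pos.1 (hn ▸ n.succ_pos : 0 < p.face.1.card)
      have hf : (p.restrict (p.face.1.erase e)).face.1 = p.face.1.erase e :=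
        Finset.inter_eq_right.2 (Finset.erase_subset _ _)
      have hlt : p.restrict (p.face.1.erase e) < p := by
        refine (restrict_le _ _).lt_of_ne fun h => ?_
        rw [h] at hf
        exact Finset.notMem_erase e p.face.1 (hf ▸ he)
      have h1 := ih (p.restrict (p.face.1.erase e))
        (by rw [hf, Finset.card_erase_of_mem he, hn]; rfl)
      have h2 := Order.height_add_one_le hlt
      push_cast
      exact (add_le_add_left h1 1).trans h2

theorem posetRank_eq (p : IndPoset G) : posetRank p = p.face.1.card := by
  rw [posetRank, height_eq]
  rfl

theorem sum_toMultiset_card (d : IndPoset G →₀ ℕ) :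
    ((Finsupp.toMultiset d).map fun a => a.face.1.card).sum = Finsupp.weight posetRank d := by
  induction d using Finsupp.induction_linear with
  | zero => simp
  | add f g hf hg => rw [map_add, map_add, Multiset.map_add, Multiset.sum_add, hf, hg]
  | single p n =>
    simp [Finsupp.weight_single, Multiset.map_nsmul, Multiset.sum_nsmul, posetRank_eq]

end IndPoset

namespace IndPoset

/-- The exponent vector of the squarefree monomial of a finite set. -/
def indicatorVec {E : Type u} (S : Finset E) : E →₀ ℕ := ∑ e ∈ S, Finsupp.single e 1

theorem indicatorVec_apply {E : Type u} [DecidableEq E] (S : Finset E) (e : E) :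
    indicatorVec S e = if e ∈ S then 1 else 0 := by
  simp [indicatorVec, Finsupp.finsetSum_apply, Finsupp.single_apply]

theorem degree_indicatorVec {E : Type u} (S : Finset E) : (indicatorVec S).degree = S.card := by
  simp [indicatorVec, map_sum]

/-! ### Evaluations of the Stanley–Reisner ring in a polynomial ring -/

section Evaluation

variable (K : Type v) [Field K] {E : Type u} {Δ : FaceComplex E}
  {G : SurjFinAbStructure.{u, w} Δ}

open Classical in
/-- The evaluation `K[P] → K[E]` attached to `y ∈ P`, on polynomials: `z` goes to the squarefree
monomial of its face if `z ≤ y` and to zero otherwise. -/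
def polyEval (y : IndPoset G) : MvPolynomial (IndPoset G) K →ₐ[K] MvPolynomial E K :=
  MvPolynomial.aeval fun z => if z ≤ y then ∏ e ∈ z.face.1, MvPolynomial.X e else 0

variable {K}

theorem polyEval_X_of_le {y z : IndPoset G} (h : z ≤ y) :
    polyEval K y (MvPolynomial.X z) = ∏ e ∈ z.face.1, MvPolynomial.X e := by
  simp [polyEval, h]

theorem polyEval_X_of_not_le {y z : IndPoset G} (h : ¬ z ≤ y) :
    polyEval K y (MvPolynomial.X z) = 0 := by
  simp [polyEval, h]

/-- If `a, b ≤ y`, exactly one minimal upper bound lies below `y`, and the relation becomes `x^A x^B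
= x^(A ∩ B) x^(A ∪ B)`. Otherwise no upper bound of `a` and `b` lies below `y`, and both sides
vanish. -/
theorem polyEval_eq_zero_of_mem [Finite E] [Subsingleton (G.grp Δ.emptyFace)] (y : IndPoset G)
    {f : MvPolynomial (IndPoset G) K} (hf : f ∈ stanleyReisnerIdeal K (IndPoset G)) :
    polyEval K y f = 0 := by
  classical
  suffices h : stanleyReisnerIdeal K (IndPoset G) ≤ RingHom.ker (polyEval K y) from h hf
  rw [stanleyReisnerIdeal, Ideal.span_le]
  rintro f ((⟨a, b, hab, rfl⟩ | ⟨a, b, c, -, hc, rfl⟩) | ⟨b, hb, rfl⟩)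
  · change polyEval K y _ = 0
    rw [map_mul]
    by_cases ha : a ≤ y
    · rw [polyEval_X_of_not_le fun hb => hab ⟨y, ha, hb⟩, mul_zero]
    · rw [polyEval_X_of_not_le ha, zero_mul]
  · change polyEval K y _ = 0
    rw [map_sub, map_mul, map_mul, map_sum, sub_eq_zero]
    by_cases h : a ≤ y ∧ b ≤ y
    · obtain ⟨ha, hb⟩ := h
      rw [Finset.sum_eq_single (y.restrict (a.face.1 ∪ b.face.1))]
      · have hmin := minimal_upperBound_restrict ha hb
        rw [polyEval_X_of_le ha, polyEval_X_of_le hb, polyEval_X_of_le (restrict_le _ _),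
          polyEval_X_of_le ((hc.1 (by simp : a ∈ ({a, b} : Set _))).trans ha),
          minimal_upperBound_face hmin, isGLB_face ha hb hc, mul_comm (∏ e ∈ _ ∩ _, _),
          Finset.prod_union_inter]
      · intro z hz hne
        simp only [Set.Finite.mem_toFinset, Set.mem_ofPred_eq] at hz
        refine polyEval_X_of_not_le fun hzy => hne ?_
        exact eq_of_face_eq hzy (restrict_le _ _) (by
          rw [minimal_upperBound_face hz,
            minimal_upperBound_face (minimal_upperBound_restrict ha hb)])
      · intro hz
        exact (hz (by simpa using minimal_upperBound_restrict ha hb)).elim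
    · rw [Finset.sum_eq_zero, mul_zero]
      · by_cases ha : a ≤ y
        · rw [polyEval_X_of_not_le (fun hb => h ⟨ha, hb⟩), mul_zero]
        · rw [polyEval_X_of_not_le ha, zero_mul]
      · intro z hz
        simp only [Set.Finite.mem_toFinset, Set.mem_ofPred_eq] at hz
        exact polyEval_X_of_not_le fun hzy => h ⟨hz.1.1.trans hzy, hz.1.2.trans hzy⟩
  · change polyEval K y _ = 0
    rw [map_sub, map_one, polyEval_X_of_le (hb y), eq_bot_of_isBot hb]
    simp [bot, FaceComplex.emptyFace]

variable [Finite E] [Subsingleton (G.grp Δ.emptyFace)]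

/-- The evaluation `K[P] → K[E]` attached to `y ∈ P`. -/
def faceEval (y : IndPoset G) : StanleyReisnerRing K (IndPoset G) →ₐ[K] MvPolynomial E K :=
  Ideal.Quotient.liftₐ _ (polyEval K y) fun _ h => polyEval_eq_zero_of_mem y h

end Evaluation

/-! ### Standard monomials form a basis -/

section StandardMonomials

variable (K : Type v) [Field K] {E : Type u} [Finite E] {Δ : FaceComplex E}
  {G : SurjFinAbStructure.{u, w} Δ}

/-- The generator of `K[P]` attached to `p ∈ P`. -/
def gen (p : IndPoset G) : StanleyReisnerRing K (IndPoset G) :=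
  Ideal.Quotient.mk _ (MvPolynomial.X p)

variable {K}

theorem gen_mul_gen_eq_zero {a b : IndPoset G} (h : ¬ ∃ z, a ≤ z ∧ b ≤ z) :
    gen K a * gen K b = 0 := by
  rw [gen, gen, ← map_mul, Ideal.Quotient.eq_zero_iff_mem]
  exact Ideal.subset_span (Or.inl (Or.inl ⟨a, b, h, rfl⟩))

theorem gen_mul_gen {a b c : IndPoset G} (h : ∃ z, a ≤ z ∧ b ≤ z) (hc : IsGLB {a, b} c) :
    gen K a * gen K b = gen K c *
      ∑ z ∈ (Set.toFinite {z : IndPoset G | Minimal (fun y => a ≤ y ∧ b ≤ y) z}).toFinset,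
        gen K z := by
  simp only [gen]
  rw [← map_mul, ← map_sum, ← map_mul, Ideal.Quotient.eq]
  exact Ideal.subset_span (Or.inl (Or.inr ⟨a, b, c, h, hc, rfl⟩))

theorem gen_bot [Subsingleton (G.grp Δ.emptyFace)] : gen K (bot G) = 1 := by
  rw [gen, ← map_one (Ideal.Quotient.mk _), Ideal.Quotient.eq]
  exact Ideal.subset_span (Or.inr ⟨_, isBot_bot, rfl⟩)

theorem prod_toMultiset_gen (d : IndPoset G →₀ ℕ) :
    ((Finsupp.toMultiset d).map (gen K)).prod =
      Ideal.Quotient.mk (stanleyReisnerIdeal K (IndPoset G)) (MvPolynomial.monomial d 1) := by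
  induction d using Finsupp.induction_linear with
  | zero => simp
  | add f g hf hg =>
    rw [map_add, Multiset.map_add, Multiset.prod_add, hf, hg, ← map_mul,
      MvPolynomial.monomial_mul, mul_one]
  | single p n =>
    simp [gen, Multiset.map_nsmul, Multiset.prod_nsmul, ← MvPolynomial.X_pow_eq_monomial]

theorem faceEval_gen_of_le [Subsingleton (G.grp Δ.emptyFace)] {y z : IndPoset G} (h : z ≤ y) :
    faceEval y (gen K z) = ∏ e ∈ z.face.1, MvPolynomial.X e :=
  polyEval_X_of_le h

theorem faceEval_gen_of_not_le [Subsingleton (G.grp Δ.emptyFace)] {y z : IndPoset G}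
    (h : ¬ z ≤ y) : faceEval y (gen K z) = 0 :=
  polyEval_X_of_not_le h

variable [DecidableEq E]

variable (K) in
/-- The standard monomial `∏_{j ≥ 0} p|_{α > j}` of the exponent vector `α`, below `p`. -/
def stdMonomial (p : IndPoset G) (α : E →₀ ℕ) : StanleyReisnerRing K (IndPoset G) :=
  ∏ j ∈ Finset.range α.degree, gen K (p.restrict (α.support.filter fun e => j < α e))

theorem stdMonomial_zero (p : IndPoset G) : stdMonomial K p 0 = 1 := by
  simp [stdMonomial]

theorem stdMonomial_mem_piece {p : IndPoset G} {α : E →₀ ℕ} (hα : α.support = p.face.1) :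
    stdMonomial K p α ∈ stanleyReisnerPiece K (IndPoset G) α.degree := by
  refine ⟨∏ j ∈ Finset.range α.degree,
    MvPolynomial.X (p.restrict (α.support.filter fun e => j < α e)), ?_, ?_⟩
  · have h := MvPolynomial.IsWeightedHomogeneous.prod (R := K) (w := posetRank)
      (Finset.range α.degree)
      (fun j => MvPolynomial.X (p.restrict (α.support.filter fun e => j < α e)))
      (fun j => posetRank (p.restrict (α.support.filter fun e => j < α e)))
      (fun j _ => MvPolynomial.isWeightedHomogeneous_X K _ _)
    have hdeg : ∑ j ∈ Finset.range α.degree,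
        posetRank (p.restrict (α.support.filter fun e => j < α e)) = α.degree := by
      have h1 : ∀ j, posetRank (p.restrict (α.support.filter fun e => j < α e)) =
          ∑ e ∈ α.support, if j < α e then 1 else 0 := fun j => by
        rw [posetRank_eq, restrict_face, ← hα, Finset.inter_eq_right.2 (Finset.filter_subset _ _),
          Finset.card_filter]
      -- Double count the pairs `(j, e)` with `j < α e`: each `e` contributes `α e`.
      rw [Finset.sum_congr rfl fun j _ => h1 j, Finset.sum_comm]
      refine Finset.sum_congr rfl fun e _ => ?_
      rw [← Finset.card_filter]
      have : (Finset.range α.degree).filter (fun j => j < α e) = Finset.range (α e) := by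
        ext j
        have := Finsupp.le_degree e α
        simp only [Finset.mem_filter, Finset.mem_range]
        omega
      rw [this, Finset.card_range]
    rw [hdeg] at h
    exact h
  · simp [stdMonomial, gen, map_prod]

variable [Subsingleton (G.grp Δ.emptyFace)]

/-- Factors with `j` at least every exponent are restrictions to `∅`, hence equal to `0̂ = 1`, so
the length of the product is immaterial beyond that. -/
theorem stdMonomial_eq_prod (p : IndPoset G) {α : E →₀ ℕ} {N : ℕ} (hN : ∀ e, α e ≤ N) :
    stdMonomial K p α =
      ∏ j ∈ Finset.range N, gen K (p.restrict (α.support.filter fun e => j < α e)) := by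
  have key : ∀ M N : ℕ, M ≤ N → (∀ e, α e ≤ M) →
      ∏ j ∈ Finset.range M, gen K (p.restrict (α.support.filter fun e => j < α e)) =
      ∏ j ∈ Finset.range N, gen K (p.restrict (α.support.filter fun e => j < α e)) := by
    intro M N hMN hM
    refine Finset.prod_subset (Finset.range_mono hMN) fun j _ hj => ?_
    have : (α.support.filter fun e => j < α e) = ∅ :=
      Finset.filter_eq_empty_iff.2 fun e _ => by
        have := hM e
        simp only [Finset.mem_range] at hj
        omega
    rw [this, eq_bot_of_face_eq_empty (p := p.restrict ∅) (Finset.inter_empty _), gen_bot]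
  have hd : ∀ e, α e ≤ α.degree := fun e => Finsupp.le_degree e α
  rcases le_total α.degree N with h | h
  · exact key _ _ h hd
  · exact (key _ _ h hN).symm

/-- Multiplying by an element above the support adds its exponent vector. -/
theorem gen_mul_stdMonomial {p q : IndPoset G} (hqp : q ≤ p) {α : E →₀ ℕ}
    (hα : α.support ⊆ q.face.1) :
    gen K p * stdMonomial K q α = stdMonomial K p (α + indicatorVec p.face.1) := by
  have hN : ∀ e, (α + indicatorVec p.face.1) e ≤ α.degree + 1 := fun e => by
    have := Finsupp.le_degree e α
    rw [Finsupp.add_apply, indicatorVec_apply]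
    split_ifs <;> omega
  have hsupp : (α + indicatorVec p.face.1).support = p.face.1 := by
    ext e
    rw [Finsupp.mem_support_iff, Finsupp.add_apply, indicatorVec_apply]
    by_cases he : e ∈ p.face.1
    · simp [he]
    · have : α e = 0 := by
        by_contra h
        exact he (face_subset hqp (hα (Finsupp.mem_support_iff.2 h)))
      simp [he, this]
  -- The factor `j = 0` is `p` itself. On the face of `p` every exponent grew by one, so the factor
  -- `j + 1` of the new product is the factor `j` of the old one.
  rw [stdMonomial_eq_prod p hN, Finset.prod_range_succ', mul_comm, stdMonomial]
  congr 1
  · refine Finset.prod_congr rfl fun j _ => congrArg _ ?_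
    refine eq_of_face_eq ((restrict_le _ _).trans hqp) (restrict_le _ _) ?_
    rw [restrict_face, restrict_face, hsupp]
    ext e
    simp only [Finset.mem_inter, Finset.mem_filter, Finsupp.add_apply, indicatorVec_apply]
    constructor
    · rintro ⟨h1, h2, h3⟩
      have := face_subset hqp h1
      simp [this, h3]
    · rintro ⟨h1, -, h3⟩
      simp only [h1, if_true] at h3
      have h4 : e ∈ α.support := Finsupp.mem_support_iff.2 (by omega)
      exact ⟨hα h4, h4, by omega⟩
  · congr 1
    refine (restrict_eq_self ?_).symm
    intro e he
    simp [hsupp, he, indicatorVec_apply]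

/-- The product of a multichain is a standard monomial. -/
theorem exists_stdMonomial_of_chain (s : Multiset (IndPoset G))
    (hs : ∀ a ∈ s, ∀ b ∈ s, a ≤ b ∨ b ≤ a) :
    ∃ (p : IndPoset G) (α : E →₀ ℕ), α.support = p.face.1 ∧
      α.degree = (s.map fun a => a.face.1.card).sum ∧ (s.map (gen K)).prod = stdMonomial K p α ∧
      ∀ z, (∀ a ∈ s, a ≤ z) → p ≤ z := by
  classical
  induction hn : s.card generalizing s with
  | zero =>
    obtain rfl := Multiset.card_eq_zero.1 hn
    refine ⟨bot G, 0, by simp [bot, FaceComplex.emptyFace], by simp, ?_, fun z _ => isBot_bot z⟩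
    simp [stdMonomial_zero]
  | succ n ih =>
    have hne : s.toFinset.Nonempty := by
      obtain ⟨a, ha⟩ := Multiset.card_pos_iff_exists_mem.1 (hn ▸ n.succ_pos : 0 < s.card)
      exact ⟨a, Multiset.mem_toFinset.2 ha⟩
    obtain ⟨p, hp, hmax⟩ := s.toFinset.exists_maximal hne
    rw [Multiset.mem_toFinset] at hp
    have hle : ∀ a ∈ s, a ≤ p := fun a ha =>
      (hs a ha p hp).elim id fun h => hmax (Multiset.mem_toFinset.2 ha) h
    obtain ⟨s', rfl⟩ := Multiset.exists_cons_of_mem hp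
    obtain ⟨q, α, h1, h2, h3, h4⟩ := ih s'
      (fun a ha b hb => hs a (Multiset.mem_cons_of_mem ha) b (Multiset.mem_cons_of_mem hb))
      (by simpa using hn)
    -- The last clause of the statement serves this step: the top of the remaining chain lies below
    -- `p`.
    have hqp : q ≤ p := h4 p fun a ha => hle a (Multiset.mem_cons_of_mem ha)
    refine ⟨p, α + indicatorVec p.face.1, ?_, ?_, ?_, fun z hz => hz p hp⟩
    · ext e
      rw [Finsupp.mem_support_iff, Finsupp.add_apply, indicatorVec_apply]
      by_cases he : e ∈ p.face.1
      · simp [he]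
      · have : α e = 0 := by
          by_contra h
          exact he (face_subset hqp (h1 ▸ (Finsupp.mem_support_iff.2 h)))
        simp [he, this]
    · rw [map_add, degree_indicatorVec, h2, Multiset.map_cons, Multiset.sum_cons, add_comm]
    · rw [Multiset.map_cons, Multiset.prod_cons, h3, gen_mul_stdMonomial hqp h1.le]

/-- The index set of the standard monomials of degree `n`. -/
abbrev StdIndex (G : SurjFinAbStructure.{u, w} Δ) (n : ℕ) : Type max u w :=
  {x : IndPoset G × (E →₀ ℕ) // x.2.support = x.1.face.1 ∧ x.2.degree = n}

variable (K G) in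
/-- The standard monomials of degree `n`. -/
def stdFamily (n : ℕ) (x : StdIndex G n) : StanleyReisnerRing K (IndPoset G) :=
  stdMonomial K x.1.1 x.1.2

/-- Straightening: replacing incomparable `a, b` by `a ∧ b` and `z` keeps the number of factors and
the degree but spreads the ranks apart. The sum of squared ranks therefore increases, and it is
bounded. -/
theorem prod_gen_mem_span (s : Multiset (IndPoset G)) :
    (s.map (gen K)).prod ∈ Submodule.span K
      (Set.range (stdFamily K G (s.map fun a => a.face.1.card).sum)) := by
  classical
  have := Fintype.ofFinite E
  have hbound : ∀ t : Multiset (IndPoset G),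
      (t.map fun a => a.face.1.card ^ 2).sum ≤ t.card * Fintype.card E ^ 2 := by
    intro t
    have := Multiset.sum_le_card_nsmul (t.map fun a => a.face.1.card ^ 2)
      (Fintype.card E ^ 2) (by
        intro x hx
        obtain ⟨a, -, rfl⟩ := Multiset.mem_map.1 hx
        exact Nat.pow_le_pow_left (Finset.card_le_univ _) 2)
    simpa using this
  induction hk : s.card * Fintype.card E ^ 2 - (s.map fun a => a.face.1.card ^ 2).sum
    using Nat.strong_induction_on generalizing s with
  | _ k ih =>
    by_cases hs : ∀ a ∈ s, ∀ b ∈ s, a ≤ b ∨ b ≤ a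
    · obtain ⟨p, α, h1, h2, h3, -⟩ := exists_stdMonomial_of_chain (K := K) s hs
      rw [h3]
      exact Submodule.subset_span ⟨⟨(p, α), h1, h2⟩, rfl⟩
    · push Not at hs
      obtain ⟨a, ha, b, hb, hab, hba⟩ := hs
      obtain ⟨t, rfl⟩ := Multiset.exists_cons_of_mem ha
      obtain ⟨t, rfl⟩ := Multiset.exists_cons_of_mem
        ((Multiset.mem_cons.1 hb).resolve_left fun h => hab h.ge)
      simp only [Multiset.map_cons, Multiset.prod_cons, ← mul_assoc]
      by_cases hz : ∃ z, a ≤ z ∧ b ≤ z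
      · obtain ⟨z₀, haz, hbz⟩ := hz
        have hc := isGLB_restrict haz hbz
        rw [gen_mul_gen ⟨z₀, haz, hbz⟩ hc, Finset.mul_sum, Finset.sum_mul]
        refine Submodule.sum_mem _ fun z hz => ?_
        simp only [Set.Finite.mem_toFinset, Set.mem_ofPred_eq] at hz
        have hzc : z.face.1.card + (a.restrict b.face.1).face.1.card =
            a.face.1.card + b.face.1.card := by
          rw [minimal_upperBound_face hz, restrict_face, Finset.card_union_add_card_inter]
        have hlt : ∀ {x y : IndPoset G}, x ≤ z₀ → y ≤ z₀ → ¬ x ≤ y →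
            (x.face.1 ∩ y.face.1).card < x.face.1.card := fun {x y} hx hy h =>
          Finset.card_lt_card (Finset.inter_subset_left.ssubset_of_ne fun he =>
            h (le_of_face_subset hx hy (Finset.inter_eq_left.1 he)))
        have h1 := hlt haz hbz hab
        have h2 := hlt hbz haz hba
        rw [Finset.inter_comm] at h2
        have hdeg : ((a ::ₘ b ::ₘ t).map fun a => a.face.1.card).sum =
            ((a.restrict b.face.1 ::ₘ z ::ₘ t).map fun a => a.face.1.card).sum := by
          simp only [Multiset.map_cons, Multiset.sum_cons]
          omega
        have h3 := ih _ ?_ (a.restrict b.face.1 ::ₘ z ::ₘ t) rfl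
        · rw [hdeg]
          simpa only [Multiset.map_cons, Multiset.prod_cons, ← mul_assoc] using h3
        -- The bound for the new multiset makes the truncated difference strictly smaller.
        · have h4 := hbound (a.restrict b.face.1 ::ₘ z ::ₘ t)
          simp only [Multiset.map_cons, Multiset.sum_cons, Multiset.card_cons,
            restrict_face] at h4 hk hzc ⊢
          -- With `i` the size of the intersection and sizes `i + u`, `i + v`, `i + u + v` of `a`,
          -- `b`, `z`, the gain is `2uv`; here `u = x + 1` and `v = y + 1`.
          have h5 : a.face.1.card ^ 2 + b.face.1.card ^ 2 <
              (a.face.1 ∩ b.face.1).card ^ 2 + z.face.1.card ^ 2 := by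
            obtain ⟨x, hx⟩ := Nat.exists_eq_add_of_lt h1
            obtain ⟨y, hy⟩ := Nat.exists_eq_add_of_lt h2
            have hzz : z.face.1.card = (a.face.1 ∩ b.face.1).card + x + y + 2 := by omega
            rw [hx, hy, hzz]
            ring_nf
            omega
          omega
      · rw [gen_mul_gen_eq_zero hz, zero_mul]
        exact Submodule.zero_mem _

/-- All factors survive, and the variable of `e` occurs in those with `j < α e`, that is, `α e`
times. -/
theorem faceEval_stdMonomial_of_le {y p : IndPoset G} (h : p ≤ y) {α : E →₀ ℕ}
    (hα : α.support = p.face.1) :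
    faceEval y (stdMonomial K p α) = MvPolynomial.monomial α 1 := by
  have h1 : ∀ j, faceEval y (gen K (p.restrict (α.support.filter fun e => j < α e))) =
      ∏ e ∈ α.support, if j < α e then (MvPolynomial.X e : MvPolynomial E K) else 1 := by
    intro j
    rw [faceEval_gen_of_le ((restrict_le _ _).trans h), restrict_face, ← hα,
      Finset.inter_eq_right.2 (Finset.filter_subset _ _), Finset.prod_filter]
  rw [stdMonomial, map_prod, Finset.prod_congr rfl fun j _ => h1 j, Finset.prod_comm,
    MvPolynomial.monomial_eq, map_one, one_mul, Finsupp.prod]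
  refine Finset.prod_congr rfl fun e _ => ?_
  rw [← Finset.prod_filter, Finset.prod_const]
  congr 1
  have : (Finset.range α.degree).filter (fun j => j < α e) = Finset.range (α e) := by
    ext j
    have := Finsupp.le_degree e α
    simp only [Finset.mem_filter, Finset.mem_range]
    omega
  rw [this, Finset.card_range]

/-- The factor `j = 0` is `p`, which evaluates to zero; it is present because `α = 0` would force `p
= 0̂ ≤ y`. -/
theorem faceEval_stdMonomial_of_not_le {y p : IndPoset G} (h : ¬ p ≤ y) {α : E →₀ ℕ}
    (hα : α.support = p.face.1) :
    faceEval y (stdMonomial K p α) = 0 := by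
  have h0 : 0 < α.degree := by
    rw [Nat.pos_iff_ne_zero]
    intro h0
    rw [Finsupp.degree_eq_zero_iff] at h0
    subst h0
    exact h (eq_bot_of_face_eq_empty (by simpa using hα.symm) ▸ isBot_bot y)
  rw [stdMonomial, map_prod]
  refine Finset.prod_eq_zero (Finset.mem_range.2 h0) ?_
  rw [restrict_eq_self, faceEval_gen_of_not_le h]
  intro e he
  rw [← hα] at he
  exact Finset.mem_filter.2 ⟨he, Nat.pos_of_ne_zero (Finsupp.mem_support_iff.1 he)⟩

/-- The functional of `(p, α)` is nonzero on `(q, β)` only if `q ≤ p` and `β = α`; then the faces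
agree, so `q = p`. -/
theorem linearIndependent_stdFamily (n : ℕ) : LinearIndependent K (stdFamily K G n) := by
  refine LinearIndependent.of_pairwise_dual_eq_zero_one _
    (fun x => MvPolynomial.lcoeff K x.1.2 ∘ₗ (faceEval x.1.1).toLinearMap) ?_ ?_
  · rintro ⟨⟨p, α⟩, hp, _⟩ ⟨⟨q, β⟩, hq, _⟩ hne
    change MvPolynomial.coeff α (faceEval p (stdMonomial K q β)) = 0
    by_cases h : q ≤ p
    · rw [faceEval_stdMonomial_of_le h hq, MvPolynomial.coeff_monomial, if_neg]
      rintro rfl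
      exact hne (Subtype.ext (Prod.ext (eq_of_face_eq h le_rfl (hq.symm.trans hp)).symm rfl))
    · rw [faceEval_stdMonomial_of_not_le h hq, MvPolynomial.coeff_zero]
  · rintro ⟨⟨p, α⟩, hp, -⟩
    change MvPolynomial.coeff α (faceEval p (stdMonomial K p α)) = 1
    rw [faceEval_stdMonomial_of_le le_rfl hp, MvPolynomial.coeff_monomial, if_pos rfl]

theorem stanleyReisnerPiece_eq_span (n : ℕ) :
    stanleyReisnerPiece K (IndPoset G) n =
      Submodule.span K (Set.range (stdFamily K G n)) := by
  apply le_antisymm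
  · rintro _ ⟨f, hf, rfl⟩
    rw [f.as_sum, map_sum]
    refine Submodule.sum_mem _ fun d hd => ?_
    have hw : Finsupp.weight posetRank d = n := hf (MvPolynomial.mem_support_iff.1 hd)
    have h := prod_gen_mem_span (K := K) (G := G) (Finsupp.toMultiset d)
    rw [sum_toMultiset_card, prod_toMultiset_gen, hw] at h
    have h3 : MvPolynomial.monomial d (f.coeff d) = f.coeff d • MvPolynomial.monomial d (1 : K) := by
      rw [MvPolynomial.smul_monomial, smul_eq_mul, mul_one]
    rw [h3, map_smul]
    exact Submodule.smul_mem _ _ h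
  · rw [Submodule.span_le]
    rintro _ ⟨⟨⟨p, α⟩, hp, rfl⟩, rfl⟩
    exact stdMonomial_mem_piece hp

instance finite_stdIndex (n : ℕ) : Finite (StdIndex G n) := by
  have := Fintype.ofFinite E
  refine Finite.of_injective (β := IndPoset G × (Finset.univ.finsuppAntidiag n : Finset (E →₀ ℕ)))
    (fun x => (x.1.1, ⟨x.1.2, ?_⟩)) ?_
  · exact Finset.mem_finsuppAntidiag.2
      ⟨(Finsupp.degree_eq_sum _).symm.trans x.2.2, Finset.subset_univ _⟩
  · rintro ⟨⟨p, α⟩, _⟩ ⟨⟨q, β⟩, _⟩ h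
    simpa using h

theorem finite_stanleyReisnerPiece (n : ℕ) :
    Module.Finite K (stanleyReisnerPiece K (IndPoset G) n) := by
  rw [stanleyReisnerPiece_eq_span]
  exact Module.Finite.span_of_finite K (Set.finite_range _)

theorem finrank_stanleyReisnerPiece (n : ℕ) :
    Module.finrank K (stanleyReisnerPiece K (IndPoset G) n) = Nat.card (StdIndex G n) := by
  have := Fintype.ofFinite (StdIndex G n)
  rw [stanleyReisnerPiece_eq_span, finrank_span_eq_card (linearIndependent_stdFamily n),
    Nat.card_eq_fintype_card]

end StandardMonomials

end IndPoset

/-! ### Hilbert series -/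

/-- The power series `t + t² + ⋯ = t / (1 - t)`. -/
def positiveSeries : PowerSeries ℚ := PowerSeries.mk fun n => if n = 0 then 0 else 1

theorem positiveSeries_mul : positiveSeries * (1 - PowerSeries.X) = PowerSeries.X := by
  ext n
  rw [mul_sub, mul_one, map_sub]
  rcases n with - | n
  · simp [positiveSeries]
  · rw [PowerSeries.coeff_succ_mul_X]
    rcases n with - | n <;> simp [positiveSeries, PowerSeries.coeff_X]

/-- Expanding the product picks a positive exponent for each element of `S`. -/
theorem coeff_positiveSeries_pow {E : Type u} (S : Finset E) (n : ℕ) :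
    PowerSeries.coeff n (positiveSeries ^ S.card) =
      (Nat.card {α : E →₀ ℕ // α.support = S ∧ α.degree = n} : ℚ) := by
  classical
  rw [← Finset.prod_const, PowerSeries.coeff_prod]
  have h1 : ∀ α ∈ S.finsuppAntidiag n,
      ∏ i ∈ S, PowerSeries.coeff (α i) positiveSeries = if α.support = S then 1 else 0 := by
    intro α hα
    have hs := (Finset.mem_finsuppAntidiag.1 hα).2
    simp only [positiveSeries, PowerSeries.coeff_mk]
    split_ifs with h
    · refine Finset.prod_eq_one fun i hi => if_neg ?_
      rw [← h] at hi
      exact Finsupp.mem_support_iff.1 hi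
    · obtain ⟨i, hi, hi'⟩ := Finset.exists_of_ssubset (hs.ssubset_of_ne h)
      exact Finset.prod_eq_zero hi (if_pos (Finsupp.notMem_support_iff.1 hi'))
  rw [Finset.sum_congr rfl h1, Finset.sum_boole, Nat.subtype_card]
  intro α
  rw [Finset.mem_filter, Finset.mem_finsuppAntidiag]
  constructor
  · rintro ⟨⟨h1, -⟩, h2⟩
    exact ⟨h2, by rw [← h1, ← h2]; rfl⟩
  · rintro ⟨h1, h2⟩
    exact ⟨⟨by rw [← h2, ← h1]; rfl, h1.le⟩, h1⟩

namespace IndPoset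

variable (K : Type v) [Field K] {E : Type u} [Finite E] [DecidableEq E] {Δ : FaceComplex E}
  {G : SurjFinAbStructure.{u, w} Δ} [Subsingleton (G.grp Δ.emptyFace)]

theorem hilbertSeries_eq [Fintype (IndPoset G)] :
    stanleyReisnerHilbertSeries K (IndPoset G) =
      ∑ p : IndPoset G, positiveSeries ^ p.face.1.card := by
  ext n
  rw [stanleyReisnerHilbertSeries, PowerSeries.coeff_mk, finrank_stanleyReisnerPiece, map_sum,
    Finset.sum_congr rfl fun p _ => coeff_positiveSeries_pow p.face.1 n, ← Nat.cast_sum]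
  congr 1
  have : ∀ p : IndPoset G, Finite {α : E →₀ ℕ // α.support = p.face.1 ∧ α.degree = n} := fun p =>
    Finite.of_injective (β := StdIndex G n) (fun α => ⟨(p, α.1), α.2⟩) fun α β h => by
      simpa [Subtype.ext_iff] using h
  rw [← Nat.card_sigma]
  exact Nat.card_congr
    { toFun := fun x => ⟨x.1.1, x.1.2, x.2⟩
      invFun := fun x => ⟨(x.1, x.2.1), x.2.2⟩
      left_inv := fun _ => rfl
      right_inv := fun _ => rfl }

theorem hilbertSeries_eq_sum_faces [Fintype Δ.Face] :
    stanleyReisnerHilbertSeries K (IndPoset G) =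
      ∑ S : Δ.Face, (Nat.card (G.grp S) : PowerSeries ℚ) * positiveSeries ^ S.1.card := by
  have : ∀ S, Fintype (G.grp S) := fun S => Fintype.ofFinite _
  let e : (Σ S : Δ.Face, G.grp S) ≃ IndPoset G :=
    { toFun := fun x => ⟨x.1, x.2⟩
      invFun := fun p => ⟨p.face, p.elt⟩
      left_inv := fun _ => rfl
      right_inv := fun _ => rfl }
  have := Fintype.ofEquiv _ e
  rw [hilbertSeries_eq, ← e.sum_comp, Fintype.sum_sigma]
  refine Finset.sum_congr rfl fun S _ => ?_
  simp [e, Nat.card_eq_fintype_card]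

end IndPoset

/-! ### The Tutte polynomial at `y = 1` -/

theorem Polynomial.reflect_finset_sum {R ι : Type*} [Semiring R] (N : ℕ) (s : Finset ι)
    (f : ι → R[X]) : (∑ i ∈ s, f i).reflect N = ∑ i ∈ s, (f i).reflect N :=
  map_sum (⟨⟨reflect N, reflect_zero⟩, fun p q => reflect_add p q N⟩ : R[X] →+ R[X]) f s

theorem Polynomial.reflect_X_sub_one_pow (k : ℕ) :
    ((X - 1 : ℤ[X]) ^ k).reflect k = (1 - X) ^ k := by
  induction k with
  | zero => simp
  | succ k ih =>
    have h1 : (X - 1 : ℤ[X]).natDegree ≤ 1 := (natDegree_X_sub_C (1 : ℤ)).le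
    have h2 : ((X - 1 : ℤ[X]) ^ k).natDegree ≤ k := by
      simpa using natDegree_pow_le_of_le k h1
    rw [pow_succ, reflect_mul _ _ h2 h1, ih, pow_succ, reflect_sub, reflect_one, pow_one]
    congr 2
    simp

theorem Polynomial.reflect_X_sub_one_pow_sub {r s : ℕ} (h : s ≤ r) :
    ((X - 1 : ℤ[X]) ^ (r - s)).reflect r = X ^ s * (1 - X) ^ (r - s) := by
  have h2 : ((X - 1 : ℤ[X]) ^ (r - s)).natDegree ≤ r - s := by
    simpa using natDegree_pow_le_of_le (r - s) (natDegree_X_sub_C (1 : ℤ)).le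
  -- The factor `1`, regarded as having degree at most `s`, reflects to `X ^ s`.
  have := reflect_mul (1 : ℤ[X]) ((X - 1 : ℤ[X]) ^ (r - s)) (F := s) (by simp) h2
  rwa [one_mul, Nat.add_sub_cancel' h, reflect_one, reflect_X_sub_one_pow] at this

namespace MultMatroid

variable {E : Type u} (A : MultMatroid E)

theorem rk_le_card (S : Finset E) : A.rk S ≤ S.card := by
  rw [rk]
  have := A.matroid.eRk_le_encard (S : Set E)
  rw [Set.encard_coe_eq_coe_finsetCard] at this
  exact ENat.toNat_le_of_le_natCast this

theorem rk_eq_card_iff (S : Finset E) : A.rk S = S.card ↔ S ∈ A.complex.faces := by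
  have h1 : A.rk S = S.card ↔ A.matroid.eRk (S : Set E) = (S : Set E).encard := by
    have := A.matroid.eRk_le_encard (S : Set E)
    rw [Set.encard_coe_eq_coe_finsetCard] at this ⊢
    rw [rk]
    constructor
    · intro h
      rw [← h, ENat.natCast_toNat]
      exact ne_top_of_le_ne_top (ENat.natCast_ne_top _) this
    · intro h
      rw [h]
      rfl
  rw [h1]
  exact (Matroid.indep_iff_eRk_eq_encard_of_finite S.finite_toSet).symm

variable [Fintype E]

theorem card_le_rank {S : Finset E} (hS : S ∈ A.complex.faces) : S.card ≤ A.rank := by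
  rw [← (A.rk_eq_card_iff S).2 hS, rank, rk, rk]
  refine ENat.toNat_le_toNat (A.matroid.eRk_mono (by simp)) ?_
  exact ne_top_of_le_ne_top (Set.encard_ne_top_iff.2 (Set.toFinite _))
    (A.matroid.eRk_le_encard _)

/-- At `y = 1` the power `(y - 1)^(|S| - rk S)` is `1` for independent `S` and `0` for all others.
-/
theorem tutte_eval_one [Fintype A.complex.Face] :
    A.tutte.eval 1 = ∑ S : A.complex.Face, (A.m S.1 : ℤ[X]) * (X - 1) ^ (A.rank - S.1.card) := by
  classical
  rw [tutte, eval_finsetSum,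
    ← Finset.sum_subtype (Finset.univ.filter (· ∈ A.complex.faces)) (by simp)
      (fun S => (A.m S : ℤ[X]) * (X - 1) ^ (A.rank - S.card)), Finset.sum_filter]
  refine Finset.sum_congr rfl fun S _ => ?_
  rw [eval_mul, eval_mul, eval_natCast, eval_C, eval_pow, eval_sub, eval_X, eval_one, sub_self]
  split_ifs with hS
  · rw [(A.rk_eq_card_iff S).2 hS, Nat.sub_self, pow_zero, mul_one]
  · have h1 := A.rk_le_card S
    have h2 : A.rk S ≠ S.card := fun h => hS ((A.rk_eq_card_iff S).1 h)
    rw [zero_pow (by omega), mul_zero]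

/-- `t^r T(1/t, 1) / (1 - t)^r` is a sum over the independent sets. -/
theorem tutteSeries_eq [Fintype A.complex.Face] :
    A.tutteSeries =
      ∑ S : A.complex.Face, (A.m S.1 : PowerSeries ℚ) * positiveSeries ^ S.1.card := by
  have hu : (PowerSeries.constantCoeff (R := ℚ) ((1 - PowerSeries.X) ^ A.rank)) ≠ 0 := by simp
  rw [tutteSeries, eq_comm, PowerSeries.eq_mul_inv_iff_mul_eq hu, tutte_eval_one,
    Polynomial.reflect_finset_sum, Polynomial.map_sum, ← Polynomial.coeToPowerSeries.ringHom_apply,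
    map_sum, Finset.sum_mul]
  refine Finset.sum_congr rfl fun S _ => ?_
  have hS := A.card_le_rank S.2
  have h1 : ∀ p : ℤ[X], ((A.m S.1 : ℤ[X]) * p).reflect A.rank = A.m S.1 * p.reflect A.rank :=
    fun p => by rw [← C_eq_natCast, reflect_C_mul]
  rw [h1,
    Polynomial.reflect_X_sub_one_pow_sub hS, Polynomial.coeToPowerSeries.ringHom_apply]
  -- The first `|S|` factors `1 - t` turn `(t/(1-t))^|S|` into `t^|S|`; the others match the
  -- reflected summand.
  have h2 : (1 - PowerSeries.X : PowerSeries ℚ) ^ A.rank =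
      (1 - PowerSeries.X) ^ S.1.card * (1 - PowerSeries.X) ^ (A.rank - S.1.card) := by
    rw [← pow_add, Nat.add_sub_cancel' hS]
  rw [h2, mul_assoc, ← mul_assoc (positiveSeries ^ _), ← mul_pow, positiveSeries_mul,
    ← Polynomial.coeToPowerSeries.ringHom_apply]
  have h3 : ((A.m S.1 : ℚ[X]) : PowerSeries ℚ) = A.m S.1 :=
    map_natCast Polynomial.coeToPowerSeries.ringHom _
  simp [h3]

end MultMatroid

/-! ### From group orders to the Hilbert series -/

theorem hasHilbertSeries_indPoset (K : Type v) [Field K] {E : Type u} [Fintype E] [DecidableEq E]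
    (A : MultMatroid E) {Δ : FaceComplex E} (hΔ : A.complex = Δ)
    (G : SurjFinAbStructure.{u, w} Δ) [Subsingleton (G.grp Δ.emptyFace)] (c : ℚ)
    (hc : ∀ S : Δ.Face, (Nat.card (G.grp S) : ℚ) = c * A.m S.1) :
    HasHilbertSeries K (IndPoset G) (c • A.tutteSeries) := by
  subst hΔ
  have := Fintype.ofFinite A.complex.Face
  refine ⟨IndPoset.finite_stanleyReisnerPiece, ?_⟩
  rw [IndPoset.hilbertSeries_eq_sum_faces, A.tutteSeries_eq, Finset.smul_sum]
  refine Finset.sum_congr rfl fun S _ => ?_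
  have h : (Nat.card (G.grp S) : PowerSeries ℚ) = c • (A.m S.1 : PowerSeries ℚ) := by
    rw [← map_natCast (algebraMap ℚ (PowerSeries ℚ)), hc, map_mul, map_natCast,
      ← Algebra.smul_def]
  rw [h, smul_mul_assoc]

/-- The orders in the torsion-free structure. -/
theorem SurjFinAbStructure.card_torsionFreePart {E : Type u} {Δ : FaceComplex E}
    (G : SurjFinAbStructure.{u, w} Δ) (S : Δ.Face) :
    Nat.card (G.grp S) = Nat.card (G.grp Δ.emptyFace) * Nat.card (G.torsionFreePart.grp S) := by
  rw [AddSubgroup.card_eq_card_quotient_mul_card_addSubgroup (G.toEmpty S).ker]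
  congr 1
  exact Nat.card_congr
    (QuotientAddGroup.quotientKerEquivOfSurjective _ (G.map_surjective _)).toEquiv

/-- The map `𝒢(∅) → 𝒢(∅)` is the identity, so its kernel is trivial; this gives the torsion-free
poset a least element. -/
instance SurjFinAbStructure.subsingleton_torsionFreePart {E : Type u} {Δ : FaceComplex E}
    (G : SurjFinAbStructure.{u, w} Δ) :
    Subsingleton (G.torsionFreePart.grp Δ.emptyFace) := by
  refine ⟨fun x y => Subtype.ext ?_⟩
  have h : ∀ z : (G.toEmpty Δ.emptyFace).ker, z.1 = 0 := fun z =>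
    (G.map_id _ z.1).symm.trans z.2
  exact (h x).trans (h y).symm

/-- The theorem for a structure whose orders are the multiplicities. -/
theorem simplicial_and_hasHilbertSeries (K : Type v) [Field K] {E : Type u} [Fintype E]
    [DecidableEq E] (A : MultMatroid E) {Δ : FaceComplex E} (hΔ : A.complex = Δ)
    (G : SurjFinAbStructure.{u, w} Δ) (hG : ∀ S : Δ.Face, Nat.card (G.grp S) = A.m S.1) :
    (A.m ∅ = 1 →
      IsSimplicialPoset (IndPoset G) ∧ HasHilbertSeries K (IndPoset G) A.tutteSeries) ∧
    (IsSimplicialPoset (IndPoset G.torsionFreePart) ∧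
      HasHilbertSeries K (IndPoset G.torsionFreePart) ((1 / (A.m ∅ : ℚ)) • A.tutteSeries)) := by
  have h0 : Nat.card (G.grp Δ.emptyFace) = A.m ∅ := hG Δ.emptyFace
  refine ⟨fun h => ?_, IndPoset.isSimplicialPoset, ?_⟩
  · have : Subsingleton (G.grp Δ.emptyFace) := (Nat.card_eq_one_iff_unique.1 (h0.trans h)).1
    refine ⟨IndPoset.isSimplicialPoset, ?_⟩
    have := hasHilbertSeries_indPoset K A hΔ G 1 fun S => by rw [hG, one_mul]
    rwa [one_smul] at this
  · refine hasHilbertSeries_indPoset K A hΔ _ _ fun S => ?_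
    have h1 := G.card_torsionFreePart S
    rw [hG, h0] at h1
    have h2 : (A.m ∅ : ℚ) ≠ 0 := by
      rw [← h0, Nat.cast_ne_zero]
      exact Nat.card_ne_zero.2 ⟨⟨0⟩, inferInstance⟩
    rw [h1]
    push_cast
    field_simp

/-! ### Orders of the layer groups -/

/-- A linear form on a saturated sublattice extends to the whole lattice. -/
theorem Submodule.exists_extend_int_dual {V : Type*} [AddCommGroup V] [Module.Finite ℤ V]
    (M : Submodule ℤ V) [Module.IsTorsionFree ℤ (V ⧸ M)] (g : M →ₗ[ℤ] ℤ) :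
    ∃ f : V →ₗ[ℤ] ℤ, ∀ x : M, f x = g x := by
  -- A finitely generated torsion-free quotient is free over `ℤ`, so the quotient map splits; `id -
  -- s ∘ mkQ` then projects `V` onto `M`.
  obtain ⟨s, hs⟩ := Module.projective_lifting_property M.mkQ LinearMap.id M.mkQ_surjective
  have hs' : ∀ v, M.mkQ (s (M.mkQ v)) = M.mkQ v := fun v => LinearMap.congr_fun hs _
  let π : V →ₗ[ℤ] M := (LinearMap.id - s ∘ₗ M.mkQ).codRestrict M fun v => by
    rw [← Submodule.Quotient.mk_eq_zero, ← Submodule.mkQ_apply, LinearMap.sub_apply, map_sub,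
      sub_eq_zero]
    exact (hs' v).symm
  refine ⟨g ∘ₗ π, fun x => congrArg g (Subtype.ext ?_)⟩
  have : M.mkQ x.1 = 0 := (Submodule.Quotient.mk_eq_zero M).2 x.2
  change x.1 - s (M.mkQ x.1) = x.1
  rw [this, map_zero, sub_zero]

/-- The independent columns are a basis of the range, and the index of a full rank sublattice is the
absolute determinant of a basis. -/
theorem Matrix.index_range_mulVecLin {n : Type*} [Fintype n] [DecidableEq n] (D : Matrix n n ℤ)
    (hD : LinearIndependent ℤ D.col) :
    (LinearMap.range D.mulVecLin).toAddSubgroup.index = D.det.natAbs := by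
  rw [Matrix.range_mulVecLin,
    AddSubgroup.index_eq_natAbs_det (Pi.basisFun ℤ n) _ (Module.Basis.span hD),
    Pi.basisFun_det]
  congr 1
  rw [Matrix.detRowAlternating, ← Matrix.det_transpose D]
  change Matrix.det _ = _
  congr 1
  ext i j
  exact congrFun (congrArg Subtype.val (Module.Basis.span_apply hD i)) j

/-- A full rank sublattice spanned by `x` has the same index as the lattice of all vectors of
values at `x` of linear forms. -/
theorem index_span_eq_index_dual {n M : Type*} [Fintype n] [DecidableEq n] [AddCommGroup M]
    (b : Module.Basis n ℤ M) {x : n → M} (hx : LinearIndependent ℤ x) :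
    (Submodule.span ℤ (Set.range x)).toAddSubgroup.index =
      (LinearMap.range (LinearMap.pi (R := ℤ) fun e =>
        LinearMap.applyₗ (R := ℤ) (M₂ := ℤ) (x e))).toAddSubgroup.index := by
  have hcol : LinearIndependent ℤ (b.toMatrix x).col :=
    hx.map' b.equivFun.toLinearMap (LinearMap.ker_eq_bot.2 b.equivFun.injective)
  have hdet : (b.toMatrix x).det ≠ 0 := fun h => by
    obtain ⟨v, hv, hv0⟩ := Matrix.exists_mulVec_eq_zero_iff.2 h
    exact hv (Matrix.mulVec_injective_iff.2 hcol (hv0.trans (Matrix.mulVec_zero _).symm))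
  have hrow : LinearIndependent ℤ (b.toMatrix x).transpose.col :=
    Matrix.linearIndependent_rows_of_det_ne_zero hdet
  have hrange : LinearMap.range (LinearMap.pi (R := ℤ) fun e =>
      LinearMap.applyₗ (R := ℤ) (M₂ := ℤ) (x e)) =
      LinearMap.range (b.toMatrix x).transpose.mulVecLin := by
    -- A form is given by its values on `b`; in these coordinates, evaluation at `x` is the
    -- transpose of the coordinate matrix of `x`.
    have h : (LinearMap.pi (R := ℤ) fun e => LinearMap.applyₗ (R := ℤ) (M₂ := ℤ) (x e)) ∘ₗ
        (b.constr ℤ).toLinearMap = (b.toMatrix x).transpose.mulVecLin := by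
      ext i e
      simp [b.toMatrix_apply, Pi.single_apply]
    rw [← h, LinearMap.range_comp_of_range_eq_top _ (LinearEquiv.range _)]
  rw [hrange, Matrix.index_range_mulVecLin _ hrow, Matrix.det_transpose,
    AddSubgroup.index_eq_natAbs_det b _ (Module.Basis.span hx), Module.Basis.det_apply]
  congr 3
  exact funext fun i => congrArg Subtype.val (Module.Basis.span_apply hx i)

section LayerCard

variable {E : Type u} {d : ℕ} (X : Matrix (Fin d) E ℤ)

theorem column_mem_saturation (S : Finset E) (e : S) :
    (fun i => X i e.1) ∈ columnSaturation X S :=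
  Submodule.subset_span ⟨e.1, e.2, rfl⟩

/-- The columns as elements of the saturation. -/
def satColumn (S : Finset E) (e : S) : columnSaturation X S :=
  ⟨fun i => X i e.1, column_mem_saturation X S e⟩

theorem linearIndependent_satColumn {S : Finset E} (hS : S ∈ (columnComplex X).faces) :
    LinearIndependent ℤ (satColumn X S) := by
  have hS' : LinearIndependent ℝ fun (e : S) (i : Fin d) => (X i e.1 : ℝ) := hS
  have h := hS'.restrict_scalars (R := ℤ) (by
    intro a b h
    simpa using h)
  exact LinearIndependent.of_comp
    ((((Int.castAddHom ℝ).compLeft (Fin d)).comp (columnSaturation X S).subtype).toIntLinearMap) h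

theorem span_satColumn (S : Finset E) :
    (Submodule.span ℤ (Set.range (satColumn X S))).toAddSubgroup =
      (columnLattice X S).addSubgroupOf (columnSaturation X S) := by
  have h : columnLattice X S = (AddSubgroup.closure (Set.range (satColumn X S))).map
      (columnSaturation X S).subtype := by
    rw [AddMonoidHom.map_closure, columnLattice, ← Set.range_comp]
    congr 1
    ext v
    constructor
    · rintro ⟨e, he, rfl⟩
      exact ⟨⟨e, he⟩, rfl⟩
    · rintro ⟨e, rfl⟩
      exact ⟨e.1, e.2, rfl⟩
  rw [h, AddSubgroup.addSubgroupOf,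
    AddSubgroup.comap_map_eq_self_of_injective (AddSubgroup.subtype_injective _)]
  exact Submodule.span_int_eq_addSubgroupClosure _

instance finite_columnSaturation (S : Finset E) : Module.Finite ℤ (columnSaturation X S) :=
  inferInstanceAs (Module.Finite ℤ (AddSubgroup.toIntSubmodule (columnSaturation X S)))

instance free_columnSaturation (S : Finset E) : Module.Free ℤ (columnSaturation X S) :=
  inferInstanceAs (Module.Free ℤ (AddSubgroup.toIntSubmodule (columnSaturation X S)))

/-- A real subspace containing `k • v` with `k ≠ 0` contains `v`. This is the hypothesis needed to
extend linear forms from the saturation. -/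
instance torsionFree_quotient_columnSaturation (S : Finset E) :
    Module.IsTorsionFree ℤ
      ((Fin d → ℤ) ⧸ AddSubgroup.toIntSubmodule (columnSaturation X S)) := by
  refine Module.IsTorsionFree.of_smul_eq_zero fun k y hy => ?_
  obtain ⟨v, rfl⟩ := Submodule.Quotient.mk_surjective _ y
  rw [or_iff_not_imp_left]
  intro hk
  rw [← Submodule.Quotient.mk_smul, Submodule.Quotient.mk_eq_zero] at hy
  rw [Submodule.Quotient.mk_eq_zero]
  have hk' : (k : ℝ) ≠ 0 := by exact_mod_cast hk
  have h1 : ((Int.castAddHom ℝ).compLeft (Fin d)) (k • v) ∈ Submodule.span ℝ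
      ((fun (e : E) (i : Fin d) => (X i e : ℝ)) '' (S : Set E)) := hy
  have h2 := Submodule.smul_mem _ (k : ℝ)⁻¹ h1
  change ((Int.castAddHom ℝ).compLeft (Fin d)) v ∈ Submodule.span ℝ
      ((fun (e : E) (i : Fin d) => (X i e : ℝ)) '' (S : Set E))
  convert h2 using 1
  ext i
  simp [hk']

/-- The columns give the lower bound. For the upper bound, pairing with the columns embeds the
saturation in `ℤ^S`: if `w = B c` and `Bᵀ w = 0`, then `Bᵀ B c = 0`, so `w = B c = 0` over `ℝ`. -/
theorem finrank_columnSaturation {S : Finset E} (hS : S ∈ (columnComplex X).faces) :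
    Module.finrank ℤ (columnSaturation X S) = S.card := by
  classical
  apply le_antisymm
  · let f : columnSaturation X S →ₗ[ℤ] (S → ℤ) :=
      (columnSubmatrix X S).transpose.mulVecLin ∘ₗ (columnSaturation X S).subtype.toIntLinearMap
    have hf : Function.Injective f := by
      rw [← LinearMap.ker_eq_bot, LinearMap.ker_eq_bot']
      intro w hw
      set B := (columnSubmatrix X S).map (Int.cast : ℤ → ℝ) with hB
      have hw1 : (fun i => (w.1 i : ℝ)) ∈ LinearMap.range B.mulVecLin := by
        rw [Matrix.range_mulVecLin]
        have := w.2
        change (fun i => (w.1 i : ℝ)) ∈ Submodule.span ℝ _ at this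
        have hr : Set.range B.col =
            (fun (e : E) (i : Fin d) => (X i e : ℝ)) '' (S : Set E) := by
          ext v
          constructor
          · rintro ⟨e, rfl⟩
            exact ⟨e.1, e.2, rfl⟩
          · rintro ⟨e, he, rfl⟩
            exact ⟨⟨e, he⟩, rfl⟩
        rwa [hr]
      obtain ⟨c, hc⟩ := hw1
      have hw2 : B.transpose.mulVec (fun i => (w.1 i : ℝ)) = 0 := by
        ext e
        have := congrArg (Int.cast : ℤ → ℝ) (congrFun hw e)
        change ((∑ i, columnSubmatrix X S i e * w.1 i : ℤ) : ℝ) = ((0 : ℤ) : ℝ) at this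
        change ∑ i, (columnSubmatrix X S i e : ℝ) * (w.1 i : ℝ) = 0
        exact_mod_cast this
      have h3 : c ∈ LinearMap.ker (B.transpose * B).mulVecLin := by
        rw [LinearMap.mem_ker, Matrix.mulVecLin_apply, ← Matrix.mulVec_mulVec]
        rw [Matrix.mulVecLin_apply] at hc
        rw [hc, hw2]
      rw [Matrix.ker_mulVecLin_transpose_mul_self, LinearMap.mem_ker, hc] at h3
      refine Subtype.ext (funext fun i => ?_)
      have := congrFun h3 i
      simpa using this
    simpa using LinearMap.finrank_le_finrank_of_injective hf
  · simpa using (linearIndependent_satColumn X hS).fintype_card_le_finrank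

/-- The lattice `I(S)` consists of the vectors of values of linear forms on the saturation. -/
theorem layerI_eq (S : Finset E) :
    layerI X S = (LinearMap.range (LinearMap.pi (R := ℤ) fun e =>
        LinearMap.applyₗ (R := ℤ) (M₂ := ℤ) (satColumn X S e))).toAddSubgroup := by
  ext w
  constructor
  · rintro ⟨v, rfl⟩
    refine ⟨(dotProductBilin ℤ ℤ v) ∘ₗ (columnSaturation X S).subtype.toIntLinearMap, ?_⟩
    ext e
    exact dotProduct_comm v (fun i => X i e.1)
  · rintro ⟨g, rfl⟩
    -- The extended form on `ℤ^d` is a dot product, whose vector is read off at the unit vectors.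
    obtain ⟨f, hf⟩ :=
      (AddSubgroup.toIntSubmodule (columnSaturation X S)).exists_extend_int_dual g
    refine ⟨fun i => f (Pi.single i 1), ?_⟩
    ext e
    refine Eq.trans ?_ (hf (satColumn X S e))
    change ∑ i, X i e.1 * f (Pi.single i 1) = f (fun i => X i e.1)
    rw [LinearMap.pi_apply_eq_sum_univ f]
    refine Finset.sum_congr rfl fun i _ => congrArg (X i e.1 * f ·) (funext fun j => ?_)
    simp [Pi.single_apply, eq_comm]

/-- `|LG(S)| = |(⟨S⟩_ℝ ∩ ℤ^d) / ⟨S⟩|` for independent `S`. -/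
theorem card_layerGroup {S : Finset E} (hS : S ∈ (columnComplex X).faces) :
    Nat.card (LayerGroup X S) =
      Nat.card (columnSaturation X S ⧸
        (columnLattice X S).addSubgroupOf (columnSaturation X S)) := by
  classical
  have hW : layerW X S = ⊤ := eq_top_iff.2 fun w _ => layerW_eq_top X hS w
  have b : Module.Basis S ℤ (columnSaturation X S) :=
    (Module.finBasisOfFinrankEq ℤ _ (finrank_columnSaturation X hS)).reindex S.equivFin.symm
  calc Nat.card (LayerGroup X S) = (layerI X S).relIndex (layerW X S) := rfl
    _ = (layerI X S).index := by rw [hW, AddSubgroup.relIndex_top_right]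
    _ = _ := by
      rw [layerI_eq, ← index_span_eq_index_dual b (linearIndependent_satColumn X hS),
        span_satColumn]
      rfl

end LayerCard

end

/-! ### The two cases: layer groups and cyclic groups -/

theorem mainTheorem1 (K : Type*) [Field K] {E : Type*} [Fintype E] [DecidableEq E]
    (A : MultMatroid E) :
    (∀ (d : ℕ) (X : Matrix (Fin d) E ℤ), A.IsArithmetic → A.IsRepresentedBy X →
      (A.m ∅ = 1 →
        IsSimplicialPoset (IndPoset (layerStructure X)) ∧
        HasHilbertSeries K (IndPoset (layerStructure X)) A.tutteSeries) ∧
      (IsSimplicialPoset (IndPoset (layerStructure X).torsionFreePart) ∧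
        HasHilbertSeries K (IndPoset (layerStructure X).torsionFreePart)
          ((1 / (A.m ∅ : ℚ)) • A.tutteSeries))) ∧
    (∀ hA : A.IsWeakQuasiArithmetic,
      (A.m ∅ = 1 →
        IsSimplicialPoset (IndPoset (A.cyclicStructure hA)) ∧
        HasHilbertSeries K (IndPoset (A.cyclicStructure hA)) A.tutteSeries) ∧
      (IsSimplicialPoset (IndPoset (A.cyclicStructure hA).torsionFreePart) ∧
        HasHilbertSeries K (IndPoset (A.cyclicStructure hA).torsionFreePart)
          ((1 / (A.m ∅ : ℚ)) • A.tutteSeries))) := by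
  refine ⟨fun d X _ hX => ?_, fun hA => ?_⟩
  · refine simplicial_and_hasHilbertSeries K A ?_ _ fun S => ?_
    · have h := hX.1
      cases hc : A.complex
      cases hc' : columnComplex X
      rw [hc, hc'] at h
      cases h
      rfl
    · exact (card_layerGroup X S.2).trans (hX.2 S.1).symm
  · exact simplicial_and_hasHilbertSeries K A rfl _ fun S => Nat.card_zmod _
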